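/- Let the $n$-qubit Pauli group be $\mathcal P_n=\{i^cX^aZ^b : c\in\mathbb Z,\ a,b\in\{0,1\}^n\}$. The $n$-qubit Clifford hierarchy is $\mathcal{CH}=\bigcup_{k\ge1}\mathcal{CH}_k$, where $\mathcal{CH}_1=\mathcal P_n$ and $\mathcal{CH}_{k+1}$ is the set of $2^n\times 2^n$ unitaries $U$ with $UPU^\dagger\in\mathcal{CH}_k$ for all $P\in\mathcal P_n$; $\mathcal{CH}_2$ is the Clifford group. A permutation gate is a $2^n\times2^n$ permutation matrix (it permutes the computational basis states), and it is a Clifford permutation if it lies in $\mathcal{CH}_2$. A multi-controlled NOT gate flips its target wire exactly when each of its control wires (any set of wires different from the target) has a prescribed value: $1$ for a closed control, $0$ for an open control. A permutation gate has wire mismatch at most $1$ if it is a finite product of multi-controlled NOT gates such that at most one wire carries both a control of some gate and a target of some gate; NOT gates without controls may occur in the product and are not counted. (a) Let $P$ be an $n$-qubit permutation gate of the form $P=P_{C_L}P_{\le1}P_{C_R}$, where $P_{C_L}$ and $P_{C_R}$ are Clifford permutations and $P_{\le1}$ is a permutation gate with wire mismatch at most $1$. Then $P\in\mathcal{CH}$.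 (b) For $k\ge 0$, adding $k$ controls to a permutation gate $U$ means passing to the gate on $k$ more qubits that applies $U$ to the original qubits if the $k$ new qubits are in a fixed basis state (each new control is open or closed), and does nothing otherwise. For each of the following gates $U$, every gate obtained from $U$ by adding any number $k\ge0$ of controls lies in $\mathcal{CH}$. Here $[t\mid S]$ is the NOT gate on wire $t$ controlled by the wires in $S$, a bar marks an open control, and gates are listed in the order in which they are applied. - $(2)$: on wires $1,2,3$, $[3\mid 1,2]$. - $(2,2)$: on wires $1,2,3,4$ (wire $1$ is bare), $[4\mid 2,3]$. - $(4)$: on wires $1,2,3,4$, $[3\mid 1,2],\ [4\mid 1,2,3]$. - $(2,2,2)$, first family: on wires $1,2,3,4$, $[2\mid\,],\ [4\mid\,],\ [4\mid 3],\ [3\mid 1,2,\bar 4],\ [2\mid 1,4],\ [4\mid 3],\ [2\mid\,],\ [4\mid\,]$. - $(2,2,2)$, second family: on wires $1,2,3,4$, $[3\mid 4],\ [4\mid \bar1,\bar2,3],\ [4\mid\bar1,2,\bar3],\ [4\mid1,\bar2,\bar3],\ [3\mid 4]$. - $(4,2)$: on wires $1,2,3$, $[3\mid\bar1],\ [2\mid\bar3]$.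 -/

import Mathlib

/-! Qubits ("wires") are indexed by a finite type `W`; `Fin n` gives `n` qubits.  A computational
basis state is a bit assignment `W → Bool`, and a gate is a complex matrix indexed by basis
states. -/

/-- Gates (matrices) on the qubits `W`. -/
abbrev QGate (W : Type*) := Matrix (W → Bool) (W → Bool) ℂ

/-- The permutation gate of a permutation of the basis states: it sends `|x⟩` to `|σ x⟩`. -/
def permGate {W : Type*} [Fintype W] [DecidableEq W] (σ : Equiv.Perm (W → Bool)) : QGate W :=
  Matrix.of fun i j => if i = σ j then 1 else 0

/-! ### Pauli group and Clifford hierarchy -/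

/-- The Pauli `X` string with an `X` exactly on the wires `w` with `a w = true`:
`|x⟩ ↦ |x ⊕ a⟩`. -/
def pauliX {W : Type*} [Fintype W] [DecidableEq W] (a : W → Bool) : QGate W :=
  Matrix.of fun i j => if i = fun w => xor (a w) (j w) then 1 else 0

/-- The Pauli `Z` string with a `Z` exactly on the wires `w` with `b w = true`:
`|x⟩ ↦ (-1)^(b · x) |x⟩`. -/
def pauliZ {W : Type*} [Fintype W] [DecidableEq W] (b : W → Bool) : QGate W :=
  Matrix.diagonal fun x => ∏ w, if b w && x w then (-1 : ℂ) else 1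

/-- The Pauli group: all `i^c X^a Z^b`. -/
def pauliGroup (W : Type*) [Fintype W] [DecidableEq W] : Set (QGate W) :=
  {M | ∃ (c : ℕ) (a b : W → Bool), M = Complex.I ^ c • (pauliX a * pauliZ b)}

/-- The `k`-th level of the Clifford hierarchy, for `k ≥ 1`: the first level is the Pauli group,
and a unitary `U` is in level `k + 1` if `U P U†` is in level `k` for every Pauli `P`.
Level `2` is the Clifford group.  There is no level `0`. -/
def cliffordLevel (W : Type*) [Fintype W] [DecidableEq W] : ℕ → Set (QGate W)
  | 0 => ∅
  | 1 => pauliGroup W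
  | k + 2 => {U | U ∈ Matrix.unitaryGroup (W → Bool) ℂ ∧
      ∀ P ∈ pauliGroup W, U * P * U.conjTranspose ∈ cliffordLevel W (k + 1)}

/-- The Clifford hierarchy: the union of its levels. -/
def cliffordHierarchy (W : Type*) [Fintype W] [DecidableEq W] : Set (QGate W) :=
  {U | ∃ k : ℕ, 1 ≤ k ∧ U ∈ cliffordLevel W k}

/-- A Clifford permutation: a permutation whose gate is in the Clifford group. -/
def IsCliffordPerm {W : Type*} [Fintype W] [DecidableEq W] (σ : Equiv.Perm (W → Bool)) : Prop :=
  permGate σ ∈ cliffordLevel W 2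

/-! ### Multi-controlled NOT gates, circuits, wire mismatch -/

/-- A multi-controlled NOT gate.  `control w = some true` is a closed control on the wire `w`
(ON for `1`), `control w = some false` an open control (ON for `0`), and `control w = none` means
that there is no control on `w`.  With no control at all it is the NOT gate (Pauli `X`). -/
structure MCX (W : Type*) where
  target : W
  control : W → Option Bool
  control_target : control target = none

namespace MCX

variable {W : Type*}

/-- All the controls are ON in the basis state `x`. -/
def IsOn (g : MCX W) (x : W → Bool) : Prop := ∀ w b, g.control w = some b → x w = b

instance [Fintype W] (g : MCX W) (x : W → Bool) : Decidable (g.IsOn x) := by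
  unfold IsOn; infer_instance

/-- The action on basis states: flip the target bit if all the controls are ON. -/
def act [Fintype W] [DecidableEq W] (g : MCX W) (x : W → Bool) : W → Bool :=
  if g.IsOn x then Function.update x g.target (!x g.target) else x

theorem act_involutive [Fintype W] [DecidableEq W] (g : MCX W) : Function.Involutive g.act := by
  intro x
  by_cases h : g.IsOn x
  · have h' : g.IsOn (Function.update x g.target (!x g.target)) := by
      intro w b hw
      have hne : w ≠ g.target := by
        rintro rfl
        simp [g.control_target] at hw
      rw [Function.update_of_ne hne]
      exact h w b hw
    simp [act, h, h']
  · simp [act, h]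

/-- The permutation of basis states performed by the gate. -/
def toPerm [Fintype W] [DecidableEq W] (g : MCX W) : Equiv.Perm (W → Bool) :=
  g.act_involutive.toPerm

end MCX

/-- The permutation performed by a circuit; the gates are listed in the order in which they are
applied (left to right in a circuit diagram). -/
def circuitPerm {W : Type*} [Fintype W] [DecidableEq W] (c : List (MCX W)) :
    Equiv.Perm (W → Bool) :=
  (c.map MCX.toPerm).reverse.prod

/-- The wire mismatch of a circuit: the number of wires that have both a target and a control on
them.  NOT gates, i.e. gates without controls, are not counted. -/
def wireMismatch {W : Type*} [Fintype W] [DecidableEq W] (c : List (MCX W)) : ℕ :=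
  (Finset.univ.filter fun w : W =>
    (∃ g ∈ c, g.target = w ∧ ∃ v, (g.control v).isSome) ∧
      ∃ g ∈ c, (g.control w).isSome).card

/-- `σ` can be written as a finite product of multi-controlled NOT gates with wire mismatch at
most `m`. -/
def HasWireMismatchLE {W : Type*} [Fintype W] [DecidableEq W] (m : ℕ)
    (σ : Equiv.Perm (W → Bool)) : Prop :=
  ∃ c : List (MCX W), circuitPerm c = σ ∧ wireMismatch c ≤ m

/-! ### Families obtained by adding controls -/

/-- The permutation `σ` of the qubits `W`, controlled on additional qubits `K`: `σ` is applied to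
the qubits `W` if the qubits `K` are in the state `p`, and otherwise nothing happens. -/
def addControls {K W : Type*} [Fintype K] [DecidableEq K] (p : K → Bool)
    (σ : Equiv.Perm (W → Bool)) : Equiv.Perm (K ⊕ W → Bool) :=
  (Equiv.sumArrowEquivProdArrow K W Bool).trans
    ((Equiv.prodCongrRight fun a => if a = p then σ else 1).trans
      (Equiv.sumArrowEquivProdArrow K W Bool).symm)

/-- Every member of the circuit family generated by the circuit `c`, that is, every permutation
gate obtained from it by adding any number `k` of (open or closed) controls, is in the Clifford
hierarchy. -/
def FamilyInCH {W : Type*} [Fintype W] [DecidableEq W] (c : List (MCX W)) : Prop :=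
  ∀ (k : ℕ) (p : Fin k → Bool),
    permGate (addControls p (circuitPerm c)) ∈ cliffordHierarchy (Fin k ⊕ W)

/-- Generator of the `(2)` family: the Toffoli gate. -/
def gen2 : List (MCX (Fin 3)) :=
  [⟨2, ![some true, some true, none], rfl⟩]

/-- Generator of the `(2,2)` family: the Toffoli gate together with one bare wire. -/
def gen22 : List (MCX (Fin 4)) :=
  [⟨3, ![none, some true, some true, none], rfl⟩]

/-- Generator of the `(4)` family. -/
def gen4 : List (MCX (Fin 4)) :=
  [⟨2, ![some true, some true, none, none], rfl⟩,
   ⟨3, ![some true, some true, some true, none], rfl⟩]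

/-- Generator of the first `(2,2,2)` family. -/
def gen222 : List (MCX (Fin 4)) :=
  [⟨1, ![none, none, none, none], rfl⟩,
   ⟨3, ![none, none, none, none], rfl⟩,
   ⟨3, ![none, none, some true, none], rfl⟩,
   ⟨2, ![some true, some true, none, some false], rfl⟩,
   ⟨1, ![some true, none, none, some true], rfl⟩,
   ⟨3, ![none, none, some true, none], rfl⟩,
   ⟨1, ![none, none, none, none], rfl⟩,
   ⟨3, ![none, none, none, none], rfl⟩]

/-- Generator of the second `(2,2,2)` family. -/
def gen222' : List (MCX (Fin 4)) :=
  [⟨2, ![none, none, none, some true], rfl⟩,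
   ⟨3, ![some false, some false, some true, none], rfl⟩,
   ⟨3, ![some false, some true, some false, none], rfl⟩,
   ⟨3, ![some true, some false, some false, none], rfl⟩,
   ⟨2, ![none, none, none, some true], rfl⟩]

/-- Generator of the `(4,2)` family. -/
def gen42 : List (MCX (Fin 3)) :=
  [⟨2, ![some false, none, none], rfl⟩,
   ⟨1, ![none, none, some false], rfl⟩]

/-! The engine is nilpotency. If a nilpotent group of unitaries contains the Pauli group, all its
elements lie in the hierarchy: `U P U† = ⁅U, P⁆ P`, so each conjugation of a Pauli moves one step
down the lower central series, which reaches `1` (`mem_cliffordHierarchy_of_isNilpotent`). Such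
groups come from 2-groups `S` of permutations containing all translations: the monomial matrices
over `S` with fourth roots of unity as nonzero entries form a finite 2-group, hence a nilpotent one,
and contain the Paulis.

The 2-groups used consist of permutations that are triangular in ranked affine coordinates. Wire
mismatch at most `1` allows the wires to be ranked so that controls precede targets, which makes the
permutation triangular. Clifford factors on either side are harmless, since levels `≥ 2` are closed
under Clifford multiplication. Triangularity also survives added controls, because the new wires can
be ranked below all others; so each generator only needs suitable coordinates. -/

/-! ### The Pauli group -/

section Pauli

variable {W : Type*} [Fintype W] [DecidableEq W]

/-- The translation `x ↦ a ⊕ x` of the basis states. -/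
def translation (a : W → Bool) : Equiv.Perm (W → Bool) :=
  Function.Involutive.toPerm (fun x w => xor (a w) (x w)) fun x => by
    funext w; simp

theorem pauliX_eq_permGate (a : W → Bool) : pauliX a = permGate (translation a) := rfl

theorem permGate_mul (σ τ : Equiv.Perm (W → Bool)) :
    permGate (σ * τ) = permGate σ * permGate τ := by
  ext i j
  simp only [permGate, Matrix.mul_apply, Matrix.of_apply, mul_ite, mul_one, mul_zero,
    Finset.sum_ite_eq', Finset.mem_univ, if_true, Equiv.Perm.mul_apply]
  split_ifs <;> simp_all

theorem permGate_one : permGate (1 : Equiv.Perm (W → Bool)) = 1 := by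
  ext i j
  simp only [permGate, Matrix.of_apply, Matrix.one_apply, Equiv.Perm.one_apply]
  split_ifs <;> simp_all

theorem conjTranspose_permGate (σ : Equiv.Perm (W → Bool)) :
    (permGate σ).conjTranspose = permGate σ⁻¹ := by
  ext i j
  simp only [permGate, Matrix.conjTranspose_apply, Matrix.of_apply, Equiv.Perm.eq_inv_iff_eq]
  by_cases h : σ i = j
  · simp [h]
  · simp [h, Ne.symm h]

theorem permGate_mem_unitaryGroup (σ : Equiv.Perm (W → Bool)) :
    permGate σ ∈ Matrix.unitaryGroup (W → Bool) ℂ := by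
  rw [Matrix.mem_unitaryGroup_iff, Matrix.star_eq_conjTranspose, conjTranspose_permGate,
    ← permGate_mul, mul_inv_cancel, permGate_one]

/-- The sign `(-1)^(b · x)`. -/
def pauliSign (b x : W → Bool) : ℂ := ∏ w, if b w && x w then (-1 : ℂ) else 1

omit [DecidableEq W] in
theorem pauliSign_eq (b x : W → Bool) : pauliSign b x = 1 ∨ pauliSign b x = -1 := by
  unfold pauliSign
  refine Finset.prod_induction _ (fun z : ℂ => z = 1 ∨ z = -1) ?_ (Or.inl rfl) ?_
  · rintro y z (rfl | rfl) (rfl | rfl) <;> simp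
  · intro w _
    split_ifs <;> simp

omit [DecidableEq W] in
theorem pauliSign_mul_self (b x : W → Bool) : pauliSign b x * pauliSign b x = 1 := by
  rcases pauliSign_eq b x with h | h <;> simp [h]

omit [DecidableEq W] in
theorem star_pauliSign (b x : W → Bool) : star (pauliSign b x) = pauliSign b x := by
  rcases pauliSign_eq b x with h | h <;> simp [h]

omit [DecidableEq W] in
theorem pauliSign_translation (b a x : W → Bool) :
    pauliSign b (translation a x) = pauliSign b a * pauliSign b x := by
  unfold pauliSign
  rw [← Finset.prod_mul_distrib]
  refine Finset.prod_congr rfl fun w _ => ?_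
  change (if b w && xor (a w) (x w) then (-1 : ℂ) else 1) = _
  cases b w <;> cases a w <;> cases x w <;> simp

theorem pauliZ_eq_diagonal (b : W → Bool) : pauliZ b = Matrix.diagonal (pauliSign b) := rfl

theorem pauliZ_mul_self (b : W → Bool) : pauliZ b * pauliZ b = 1 := by
  simp [pauliZ_eq_diagonal, Matrix.diagonal_mul_diagonal, pauliSign_mul_self]

theorem pauliZ_mem_unitaryGroup (b : W → Bool) :
    pauliZ b ∈ Matrix.unitaryGroup (W → Bool) ℂ := by
  have h : star (pauliZ b) = pauliZ b := by
    rw [Matrix.star_eq_conjTranspose, pauliZ_eq_diagonal, Matrix.diagonal_conjTranspose]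
    congr 1
    funext x
    exact star_pauliSign b x
  rw [Matrix.mem_unitaryGroup_iff, h, pauliZ_mul_self]

theorem pauliZ_mul_pauliX (b a : W → Bool) :
    pauliZ b * pauliX a = pauliSign b a • (pauliX a * pauliZ b) := by
  ext i j
  rw [pauliX_eq_permGate, pauliZ_eq_diagonal, Matrix.smul_apply, Matrix.diagonal_mul,
    Matrix.mul_diagonal]
  simp only [permGate, Matrix.of_apply, smul_eq_mul]
  split_ifs with h
  · rw [h, pauliSign_translation]; ring
  · simp

theorem pauliX_mul_comm (a a' : W → Bool) : pauliX a * pauliX a' = pauliX a' * pauliX a := by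
  rw [pauliX_eq_permGate, pauliX_eq_permGate, ← permGate_mul, ← permGate_mul]
  congr 1
  ext x w
  change xor (a w) (xor (a' w) (x w)) = xor (a' w) (xor (a w) (x w))
  rw [Bool.xor_left_comm]

theorem pauliZ_mul_comm (b b' : W → Bool) : pauliZ b * pauliZ b' = pauliZ b' * pauliZ b := by
  simp [pauliZ_eq_diagonal, Matrix.diagonal_mul_diagonal, mul_comm]

theorem I_pow_mem_unitary (c : ℕ) : Complex.I ^ c ∈ unitary ℂ := by
  refine pow_mem ?_ c
  rw [Unitary.mem_iff]
  simp

theorem mem_unitaryGroup_of_mem_pauliGroup {M : QGate W} (hM : M ∈ pauliGroup W) :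
    M ∈ Matrix.unitaryGroup (W → Bool) ℂ := by
  obtain ⟨c, a, b, rfl⟩ := hM
  have hu : pauliX a * pauliZ b ∈ Matrix.unitaryGroup (W → Bool) ℂ :=
    mul_mem (permGate_mem_unitaryGroup (translation a)) (pauliZ_mem_unitaryGroup b)
  exact Unitary.smul_mem_of_mem (I_pow_mem_unitary c) hu

/-- Conjugating a Pauli by a Pauli changes at most its sign. -/
theorem pauli_conj_mem_pauliGroup {M N : QGate W} (hM : M ∈ pauliGroup W)
    (hN : N ∈ pauliGroup W) : M * N * M.conjTranspose ∈ pauliGroup W := by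
  have hMM : M * M.conjTranspose = 1 :=
    Matrix.mem_unitaryGroup_iff.1 (mem_unitaryGroup_of_mem_pauliGroup hM)
  obtain ⟨c, a, b, hM'⟩ := hM
  obtain ⟨c', a', b', rfl⟩ := hN
  have hcomm : (pauliX a * pauliZ b) * (pauliX a' * pauliZ b') =
      (pauliSign b a' * pauliSign b' a) • ((pauliX a' * pauliZ b') * (pauliX a * pauliZ b)) := by
    have h1 : (pauliX a * pauliZ b) * (pauliX a' * pauliZ b') =
        pauliX a * (pauliZ b * pauliX a') * pauliZ b' := by simp only [mul_assoc]
    have h2 : (pauliX a' * pauliZ b') * (pauliX a * pauliZ b) =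
        pauliX a' * (pauliZ b' * pauliX a) * pauliZ b := by simp only [mul_assoc]
    rw [h1, h2, pauliZ_mul_pauliX, pauliZ_mul_pauliX]
    simp only [mul_smul_comm, smul_mul_assoc, smul_smul, mul_assoc]
    rw [pauliSign_mul_self, mul_one, pauliZ_mul_comm b b', ← mul_assoc (pauliX a),
      pauliX_mul_comm, mul_assoc]
  have hconj : M * (Complex.I ^ c' • (pauliX a' * pauliZ b')) * M.conjTranspose =
      (pauliSign b a' * pauliSign b' a) • Complex.I ^ c' • (pauliX a' * pauliZ b') := by
    have h3 : M * (Complex.I ^ c' • (pauliX a' * pauliZ b')) =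
        ((pauliSign b a' * pauliSign b' a) • Complex.I ^ c' • (pauliX a' * pauliZ b')) * M := by
      rw [hM']
      simp only [mul_smul_comm, smul_mul_assoc]
      rw [hcomm]
      simp only [smul_smul]
      congr 1
      ring
    rw [h3, mul_assoc, hMM, mul_one]
  rw [hconj]
  have hs : pauliSign b a' * pauliSign b' a = 1 ∨ pauliSign b a' * pauliSign b' a = -1 := by
    rcases pauliSign_eq b a' with h | h <;> rcases pauliSign_eq b' a with h' | h' <;> simp [h, h']
  rcases hs with h | h
  · exact ⟨c', a', b', by rw [h, one_smul]⟩
  -- The sign `-1` is absorbed into the phase as `I ^ 2`.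
  · exact ⟨c' + 2, a', b', by rw [h, smul_smul, pow_add, Complex.I_sq]; congr 1; ring⟩

theorem finite_pauliGroup (W : Type*) [Fintype W] [DecidableEq W] : (pauliGroup W).Finite := by
  refine (Set.finite_range fun t : Fin 4 × (W → Bool) × (W → Bool) =>
    Complex.I ^ (t.1 : ℕ) • (pauliX t.2.1 * pauliZ t.2.2)).subset ?_
  rintro _ ⟨c, a, b, rfl⟩
  refine ⟨(⟨c % 4, Nat.mod_lt _ (by norm_num)⟩, a, b), ?_⟩
  simp only
  rw [← Complex.I_pow_eq_pow_mod]

end Pauli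

/-! ### Closure of the Clifford hierarchy under Clifford multiplication -/

section Clifford

variable {W : Type*} [Fintype W] [DecidableEq W]

/-- The inverse of a Clifford gate is Clifford. -/
theorem conjTranspose_mem_cliffordLevel_two {C : QGate W} (hC : C ∈ cliffordLevel W 2) :
    C.conjTranspose ∈ cliffordLevel W 2 := by
  have hu : star C * C = 1 := Matrix.mem_unitaryGroup_iff'.1 hC.1
  refine ⟨Unitary.star_mem hC.1, fun P hP => ?_⟩
  have : Finite (pauliGroup W) := finite_pauliGroup W
  -- Conjugation by `C` is an injective self-map of the finite Pauli group, hence surjective: every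
  -- Pauli `P` is `C N C†`, so `C† P C = N` is again a Pauli.
  have hinj : Function.Injective fun N : pauliGroup W =>
      (⟨C * N.1 * C.conjTranspose, hC.2 N.1 N.2⟩ : pauliGroup W) := by
    intro M N h
    have h' : star C * (C * M.1 * star C) * C = star C * (C * N.1 * star C) * C := by
      have h'' : C * M.1 * star C = C * N.1 * star C := congrArg Subtype.val h
      rw [h'']
    refine Subtype.ext ?_
    simpa only [← mul_assoc, hu, one_mul, mul_assoc _ (star C) C, mul_one] using h'
  obtain ⟨N, hN⟩ := Finite.injective_iff_surjective.1 hinj ⟨P, hP⟩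
  have hN' : C * N.1 * star C = P := congrArg Subtype.val hN
  have : C.conjTranspose * P * C.conjTranspose.conjTranspose = N.1 := by
    rw [Matrix.conjTranspose_conjTranspose, ← Matrix.star_eq_conjTranspose, ← hN']
    simp only [← mul_assoc, hu, one_mul, mul_assoc _ (star C) C, mul_one]
  rw [this]
  exact N.2

/-- `(UC) P (UC)† = U (C P C†) U†`, and `C P C†` is again a Pauli. -/
theorem mul_clifford_mem_cliffordLevel {k : ℕ} {U C : QGate W}
    (hU : U ∈ cliffordLevel W (k + 2)) (hC : C ∈ cliffordLevel W 2) :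
    U * C ∈ cliffordLevel W (k + 2) := by
  refine ⟨mul_mem hU.1 hC.1, fun P hP => ?_⟩
  have h := hU.2 _ (hC.2 P hP)
  simpa only [Matrix.conjTranspose_mul, mul_assoc] using h

/-- Induction on the level, from `(C U C†) P (C U C†)† = C (U (C† P C) U†) C†`, where `C† P C` is a
Pauli. -/
theorem clifford_conj_mem_cliffordLevel {C : QGate W} (hC : C ∈ cliffordLevel W 2) :
    ∀ {k : ℕ} {U : QGate W}, U ∈ cliffordLevel W (k + 1) →
      C * U * C.conjTranspose ∈ cliffordLevel W (k + 1)
  | 0, U, hU => hC.2 U hU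
  | k + 1, U, hU => by
    refine ⟨mul_mem (mul_mem hC.1 hU.1) (Unitary.star_mem hC.1), fun P hP => ?_⟩
    have h := clifford_conj_mem_cliffordLevel hC
      (hU.2 _ ((conjTranspose_mem_cliffordLevel_two hC).2 P hP))
    simpa only [Matrix.conjTranspose_mul, Matrix.conjTranspose_conjTranspose, mul_assoc] using h

/-- Write `C U = (C U C†) C`, reducing to conjugation and right multiplication. -/
theorem clifford_mul_mem_cliffordLevel {k : ℕ} {U C : QGate W}
    (hC : C ∈ cliffordLevel W 2) (hU : U ∈ cliffordLevel W (k + 2)) :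
    C * U ∈ cliffordLevel W (k + 2) := by
  have hu : C.conjTranspose * C = 1 := Matrix.mem_unitaryGroup_iff'.1 hC.1
  have h := mul_clifford_mem_cliffordLevel (clifford_conj_mem_cliffordLevel hC hU) hC
  rwa [mul_assoc, hu, mul_one] at h

theorem pauliGroup_subset_cliffordLevel_two : pauliGroup W ⊆ cliffordLevel W 2 := fun _ hM =>
  ⟨mem_unitaryGroup_of_mem_pauliGroup hM, fun _ hP => pauli_conj_mem_pauliGroup hM hP⟩

theorem clifford_mul_mul_clifford_mem_cliffordHierarchy {C U D : QGate W}
    (hC : C ∈ cliffordLevel W 2) (hU : U ∈ cliffordHierarchy W) (hD : D ∈ cliffordLevel W 2) :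
    C * U * D ∈ cliffordHierarchy W := by
  obtain ⟨k, hk, hU⟩ := hU
  match k, hk, hU with
  -- Level `1` is not closed under Clifford multiplication, so a Pauli is first regarded as a
  -- Clifford gate.
  | 1, _, hU =>
    exact ⟨2, by norm_num, mul_clifford_mem_cliffordLevel (k := 0)
      (clifford_mul_mem_cliffordLevel (k := 0) hC (pauliGroup_subset_cliffordLevel_two hU)) hD⟩
  | k + 2, _, hU =>
    exact ⟨k + 2, by omega,
      mul_clifford_mem_cliffordLevel (clifford_mul_mem_cliffordLevel hC hU) hD⟩

end Clifford

/-! ### Nilpotent groups containing the Pauli group -/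

section Nilpotent

open scoped commutatorElement

variable {W : Type*} [Fintype W] [DecidableEq W]

/-- With `Q = P N P†`, a Pauli, `(g P) N (g P)† = g Q g† = ⁅g, Q⁆ Q`, and the commutator lies one
term further down the series. The trailing Pauli factor is carried in the statement so that the
induction hypothesis applies to this product. -/
theorem lowerCentralSeries_mul_pauli_mem_cliffordLevel
    (G : Subgroup (Matrix.unitaryGroup (W → Bool) ℂ))
    (hG : ∀ M ∈ pauliGroup W, ∃ g ∈ G, (g : QGate W) = M) :
    ∀ (m j : ℕ), (⊤ : Subgroup G).lowerCentralSeries (j + m) = ⊥ →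
      ∀ g ∈ (⊤ : Subgroup G).lowerCentralSeries j, ∀ P ∈ pauliGroup W,
        ((g : Matrix.unitaryGroup (W → Bool) ℂ) : QGate W) * P ∈ cliffordLevel W (m + 1)
  | 0, j, hj, g, hg, P, hP => by
    rw [add_zero] at hj
    rw [hj, Subgroup.mem_bot] at hg
    subst hg
    change (1 : QGate W) * P ∈ pauliGroup W
    rwa [one_mul]
  | m + 1, j, hj, g, hg, P, hP => by
    refine ⟨mul_mem g.1.2 (mem_unitaryGroup_of_mem_pauliGroup hP), fun N hN => ?_⟩
    have hQ := pauli_conj_mem_pauliGroup hP hN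
    obtain ⟨q, hqG, hq⟩ := hG _ hQ
    have hcomm : ⁅g, (⟨q, hqG⟩ : G)⁆ ∈ (⊤ : Subgroup G).lowerCentralSeries (j + 1) :=
      Subgroup.commutator_mem_commutator hg (Subgroup.mem_top _)
    have h := lowerCentralSeries_mul_pauli_mem_cliffordLevel G hG m (j + 1)
      (by rw [← hj]; congr 1; ring) _ hcomm _ hQ
    convert h using 1
    have hqq : star (q : QGate W) * q = 1 := Matrix.mem_unitaryGroup_iff'.1 q.2
    have hcoe : ((⁅g, (⟨q, hqG⟩ : G)⁆ : G).1 : QGate W) =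
        (g.1 : QGate W) * q * star (g.1 : QGate W) * star (q : QGate W) := rfl
    rw [hcoe, ← hq, mul_assoc _ (star (q : QGate W)), hqq, mul_one, hq]
    simp only [Matrix.conjTranspose_mul, Matrix.star_eq_conjTranspose, mul_assoc]

/-- A unitary that lies in a nilpotent group of unitaries containing the Pauli group is in the
Clifford hierarchy. -/
theorem mem_cliffordHierarchy_of_isNilpotent
    (G : Subgroup (Matrix.unitaryGroup (W → Bool) ℂ)) [hn : Group.IsNilpotent G]
    (hG : ∀ M ∈ pauliGroup W, ∃ g ∈ G, (g : QGate W) = M)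
    {U : Matrix.unitaryGroup (W → Bool) ℂ} (hU : U ∈ G) :
    (U : QGate W) ∈ cliffordHierarchy W := by
  obtain ⟨n, hn⟩ := Subgroup.nilpotent_iff_lowerCentralSeries.1 hn
  refine ⟨n + 1, by omega, ?_⟩
  have h1 : (1 : QGate W) ∈ pauliGroup W := by
    refine ⟨0, fun _ => false, fun _ => false, ?_⟩
    ext i j
    simp [pauliX, pauliZ, Matrix.one_apply]
  simpa using lowerCentralSeries_mul_pauli_mem_cliffordLevel G hG n 0 (by simpa using hn)
    ⟨U, hU⟩ (Subgroup.mem_top _) 1 h1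

/-- `M` is a monomial matrix with underlying permutation `σ` and entries fourth roots of unity. -/
def IsPhasedPerm (σ : Equiv.Perm (W → Bool)) (M : QGate W) : Prop :=
  ∀ i j, (i = σ j → M i j ^ 4 = 1) ∧ (i ≠ σ j → M i j = 0)

theorem isPhasedPerm_permGate (σ : Equiv.Perm (W → Bool)) : IsPhasedPerm σ (permGate σ) := by
  intro i j
  constructor <;> intro h <;> simp [permGate, h]

theorem IsPhasedPerm.mul {σ τ : Equiv.Perm (W → Bool)} {M N : QGate W}
    (hM : IsPhasedPerm σ M) (hN : IsPhasedPerm τ N) : IsPhasedPerm (σ * τ) (M * N) := by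
  intro i j
  have h : (M * N) i j = M i (τ j) * N (τ j) j := by
    rw [Matrix.mul_apply]
    refine Finset.sum_eq_single _ (fun k _ hk => ?_) (by simp)
    rw [(hN k j).2 hk, mul_zero]
  rw [h]
  refine ⟨fun hi => ?_, fun hi => ?_⟩
  · rw [mul_pow, (hM i _).1 hi, (hN _ j).1 rfl, one_mul]
  · rw [(hM i _).2 hi, zero_mul]

omit [Fintype W] [DecidableEq W] in
theorem IsPhasedPerm.star {σ : Equiv.Perm (W → Bool)} {M : QGate W}
    (hM : IsPhasedPerm σ M) : IsPhasedPerm σ⁻¹ (star M) := by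
  intro i j
  rw [Matrix.star_apply, Equiv.Perm.eq_inv_iff_eq, Ne, Equiv.Perm.eq_inv_iff_eq]
  refine ⟨fun h => ?_, fun h => ?_⟩
  · rw [← star_pow, (hM j i).1 h.symm, star_one]
  · rw [(hM j i).2 (Ne.symm h), star_zero]

theorem IsPhasedPerm.one : IsPhasedPerm (1 : Equiv.Perm (W → Bool)) (1 : QGate W) := by
  simpa only [permGate_one] using isPhasedPerm_permGate (1 : Equiv.Perm (W → Bool))

theorem IsPhasedPerm.pow {σ : Equiv.Perm (W → Bool)} {M : QGate W}
    (hM : IsPhasedPerm σ M) : ∀ n : ℕ, IsPhasedPerm (σ ^ n) (M ^ n)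
  | 0 => by simpa using IsPhasedPerm.one
  | n + 1 => by
    rw [pow_succ, pow_succ]
    exact (hM.pow n).mul hM

theorem IsPhasedPerm.pow_four_eq_one {M : QGate W} (hM : IsPhasedPerm 1 M) : M ^ 4 = 1 := by
  have h : M = Matrix.diagonal fun i => M i i := by
    ext i j
    by_cases hij : i = j
    · simp [hij]
    · rw [Matrix.diagonal_apply_ne _ hij]
      exact (hM i j).2 hij
  rw [h, Matrix.diagonal_pow, ← Matrix.diagonal_one]
  congr 1
  funext i
  exact (hM i i).1 rfl

theorem isPhasedPerm_pauli (c : ℕ) (a b : W → Bool) :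
    IsPhasedPerm (translation a) (Complex.I ^ c • (pauliX a * pauliZ b)) := by
  intro i j
  rw [pauliX_eq_permGate, pauliZ_eq_diagonal, Matrix.smul_apply, Matrix.mul_diagonal]
  refine ⟨fun h => ?_, fun h => by simp [permGate, h]⟩
  simp only [permGate, Matrix.of_apply, h, if_true, one_mul, smul_eq_mul]
  rw [mul_pow, ← pow_mul, mul_comm c, pow_mul, Complex.I_pow_four, one_pow, one_mul]
  rcases pauliSign_eq b j with h | h <;> rw [h] <;> norm_num

/-- The group of monomial unitaries with entries fourth roots of unity and underlying permutation
in `S`. -/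
def phasedPermSubgroup (S : Subgroup (Equiv.Perm (W → Bool))) :
    Subgroup (Matrix.unitaryGroup (W → Bool) ℂ) where
  carrier := {U | ∃ σ ∈ S, IsPhasedPerm σ (U : QGate W)}
  mul_mem' := by
    rintro U V ⟨σ, hσ, hU⟩ ⟨τ, hτ, hV⟩
    exact ⟨σ * τ, mul_mem hσ hτ, hU.mul hV⟩
  one_mem' := ⟨1, one_mem S, IsPhasedPerm.one⟩
  inv_mem' := by
    rintro U ⟨σ, hσ, hU⟩
    exact ⟨σ⁻¹, inv_mem hσ, hU.star⟩

theorem finite_phasedPermSubgroup (S : Subgroup (Equiv.Perm (W → Bool))) :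
    Finite (phasedPermSubgroup S) := by
  have hF : {z : ℂ | z ^ 4 = 1 ∨ z = 0}.Finite := by
    -- All possible entries, `0` and the fourth roots of unity, are roots of `X ^ 5 - X`.
    have hp : (Polynomial.X ^ 5 - Polynomial.X : Polynomial ℂ) ≠ 0 := fun h => by
      have := congrArg (Polynomial.eval 2) h
      norm_num at this
    refine (Polynomial.finite_setOfPred_isRoot hp).subset ?_
    rintro z (h | rfl)
    · change Polynomial.eval z _ = 0
      simp only [Polynomial.eval_sub, Polynomial.eval_pow, Polynomial.eval_X]
      rw [pow_succ, h]
      ring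
    · simp [Polynomial.IsRoot]
  have : Finite {z : ℂ | z ^ 4 = 1 ∨ z = 0} := hF
  refine Finite.of_injective (fun (U : phasedPermSubgroup S) (i j : W → Bool) =>
    (⟨(U.1 : QGate W) i j, ?_⟩ : {z : ℂ | z ^ 4 = 1 ∨ z = 0})) ?_
  · obtain ⟨σ, _, h⟩ := U.2
    by_cases hij : i = σ j
    · exact Or.inl ((h i j).1 hij)
    · exact Or.inr ((h i j).2 hij)
  · intro U V h
    refine Subtype.ext (Subtype.ext ?_)
    ext i j
    exact congrArg Subtype.val (congrFun (congrFun h i) j)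

/-- Once `σ ^ 2 ^ k = 1`, the matrix `U ^ 2 ^ k` is diagonal with fourth roots of unity on the
diagonal, so two more squarings give `1`. -/
theorem isPGroup_phasedPermSubgroup {S : Subgroup (Equiv.Perm (W → Bool))}
    (hS : IsPGroup 2 S) : IsPGroup 2 (phasedPermSubgroup S) := by
  rintro ⟨U, σ, hσ, hU⟩
  obtain ⟨k, hk⟩ := hS ⟨σ, hσ⟩
  have hk' : σ ^ 2 ^ k = 1 := congrArg Subtype.val hk
  refine ⟨k + 2, Subtype.ext (Subtype.ext ?_)⟩
  have h := hU.pow (2 ^ k)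
  rw [hk'] at h
  have h4 := h.pow_four_eq_one
  rw [← pow_mul] at h4
  change (U : QGate W) ^ 2 ^ (k + 2) = 1
  rw [pow_add]
  exact h4

/-- A permutation gate whose permutation lies in a `2`-group of permutations containing all the
translations is in the Clifford hierarchy. -/
theorem permGate_mem_cliffordHierarchy_of_isPGroup {S : Subgroup (Equiv.Perm (W → Bool))}
    (hS : IsPGroup 2 S) (htr : ∀ a, translation a ∈ S) {σ : Equiv.Perm (W → Bool)}
    (hσ : σ ∈ S) : permGate σ ∈ cliffordHierarchy W := by
  have := finite_phasedPermSubgroup S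
  have : Group.IsNilpotent (phasedPermSubgroup S) := (isPGroup_phasedPermSubgroup hS).isNilpotent
  refine mem_cliffordHierarchy_of_isNilpotent (phasedPermSubgroup S) ?_
    (U := ⟨permGate σ, permGate_mem_unitaryGroup σ⟩) ⟨σ, hσ, isPhasedPerm_permGate σ⟩
  intro M hM
  refine ⟨⟨M, mem_unitaryGroup_of_mem_pauliGroup hM⟩, ?_, rfl⟩
  obtain ⟨c, a, b, rfl⟩ := hM
  exact ⟨translation a, htr a, isPhasedPerm_pauli c a b⟩

end Nilpotent

/-! ### Triangular permutations -/

section Triangular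

variable {W : Type*}

/-- `σ` is triangular with respect to the coordinates `f` ranked by `r`: it changes each
coordinate by an amount that depends only on the coordinates of smaller rank. -/
def IsTriangular (f : W → (W → Bool) → Bool) (r : W → ℕ) (σ : Equiv.Perm (W → Bool)) : Prop :=
  ∀ w x y, (∀ v, r v < r w → f v x = f v y) →
    xor (f w (σ x)) (f w x) = xor (f w (σ y)) (f w y)

variable {f : W → (W → Bool) → Bool} {r : W → ℕ}

/-- This lets triangularity be applied to `σ` after another triangular map, giving closure under
composition. -/
theorem IsTriangular.congr {σ : Equiv.Perm (W → Bool)} (hσ : IsTriangular f r σ) {w : W}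
    {x y : W → Bool} (h : ∀ v, r v < r w → f v x = f v y) :
    ∀ v, r v < r w → f v (σ x) = f v (σ y) := by
  intro v hv
  have h' := hσ v x y fun u hu => h u (hu.trans hv)
  rw [h v hv] at h'
  simpa using h'

/-- The triangular permutations. -/
def triangularSubmonoid (f : W → (W → Bool) → Bool) (r : W → ℕ) :
    Submonoid (Equiv.Perm (W → Bool)) where
  carrier := {σ | IsTriangular f r σ}
  mul_mem' := by
    intro σ τ hσ hτ w x y h
    have h1 := hσ w _ _ (hτ.congr h)
    have h2 := hτ w x y h
    change xor (f w (σ (τ x))) (f w x) = xor (f w (σ (τ y))) (f w y)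
    revert h1 h2
    generalize f w (σ (τ x)) = a₁
    generalize f w (σ (τ y)) = a₂
    generalize f w (τ x) = a₃
    generalize f w (τ y) = a₄
    generalize f w x = a₅
    generalize f w y = a₆
    decide +revert
  one_mem' := by
    intro w x y _
    simp

/-- Inductively, `τ = σ ^ 2 ^ m` fixes the coordinates of rank below `m`. Hence at rank `m` it
changes the coordinate by the same bit at `x` and at `τ x`, and these two changes cancel in `τ ^ 2`.
-/
theorem IsTriangular.pow_two_pow_fix {σ : Equiv.Perm (W → Bool)} (hσ : IsTriangular f r σ) :
    ∀ (m : ℕ) (w : W), r w < m → ∀ x, f w ((σ ^ 2 ^ m) x) = f w x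
  | 0, w, hw, x => absurd hw (Nat.not_lt_zero _)
  | m + 1, w, hw, x => by
    have ih := hσ.pow_two_pow_fix m
    have ht : IsTriangular f r (σ ^ 2 ^ m) := (triangularSubmonoid f r).pow_mem hσ _
    have h := ht w ((σ ^ 2 ^ m) x) x fun v hv => ih v (by omega) x
    rw [pow_succ, mul_two, pow_add, Equiv.Perm.mul_apply]
    revert h
    generalize f w ((σ ^ 2 ^ m) ((σ ^ 2 ^ m) x)) = a₁
    generalize f w ((σ ^ 2 ^ m) x) = a₂
    generalize f w x = a₃
    decide +revert

theorem IsTriangular.pow_two_pow_eq_one [Fintype W] {σ : Equiv.Perm (W → Bool)}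
    (hσ : IsTriangular f r σ) (hf : ∀ x y, (∀ w, f w x = f w y) → x = y) :
    ∃ k, σ ^ 2 ^ k = 1 := by
  refine ⟨Finset.univ.sup r + 1, Equiv.ext fun x => hf _ _ fun w => ?_⟩
  exact hσ.pow_two_pow_fix _ w (Nat.lt_succ_of_le (Finset.le_sup (Finset.mem_univ w))) x

/-- The group of triangular permutations. -/
def triangularSubgroup [Fintype W] (f : W → (W → Bool) → Bool) (r : W → ℕ)
    (hf : ∀ x y, (∀ w, f w x = f w y) → x = y) : Subgroup (Equiv.Perm (W → Bool)) where
  toSubmonoid := triangularSubmonoid f r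
  inv_mem' := by
    intro σ hσ
    obtain ⟨k, hk⟩ := IsTriangular.pow_two_pow_eq_one hσ hf
    -- Since `σ` has finite order, its inverse is a natural power and stays in the submonoid.
    have h : σ⁻¹ = σ ^ (2 ^ k - 1) := by
      rw [inv_eq_iff_mul_eq_one, ← pow_succ', Nat.sub_add_cancel Nat.one_le_two_pow, hk]
    rw [h]
    exact (triangularSubmonoid f r).pow_mem hσ _

theorem isPGroup_triangularSubgroup [Fintype W] (hf : ∀ x y, (∀ w, f w x = f w y) → x = y) :
    IsPGroup 2 (triangularSubgroup f r hf) := by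
  rintro ⟨σ, hσ⟩
  obtain ⟨k, hk⟩ := IsTriangular.pow_two_pow_eq_one hσ hf
  exact ⟨k, Subtype.ext hk⟩

variable [Fintype W] [DecidableEq W]

/-- A permutation that is triangular in some affine coordinate system is in the Clifford
hierarchy. -/
theorem IsTriangular.permGate_mem_cliffordHierarchy {σ : Equiv.Perm (W → Bool)}
    (hσ : IsTriangular f r σ) (hf : ∀ x y, (∀ w, f w x = f w y) → x = y)
    (haff : ∀ a w x y, xor (f w (translation a x)) (f w x) = xor (f w (translation a y)) (f w y)) :
    permGate σ ∈ cliffordHierarchy W :=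
  permGate_mem_cliffordHierarchy_of_isPGroup (S := triangularSubgroup f r hf)
    (isPGroup_triangularSubgroup hf) (fun a w x y _ => haff a w x y) hσ

/-- Only the target bit can change, and whether it flips is decided by the control bits, all of
smaller rank. -/
theorem MCX.isTriangular_toPerm (g : MCX W) (r : W → ℕ)
    (hr : ∀ v, (g.control v).isSome → r v < r g.target) :
    IsTriangular (fun w x => x w) r g.toPerm := by
  intro w x y h
  change xor (g.act x w) (x w) = xor (g.act y w) (y w)
  by_cases hw : w = g.target
  · subst hw
    have hon : g.IsOn x ↔ g.IsOn y := by
      refine forall₃_congr fun v b hv => ?_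
      have hxy : x v = y v := h v (hr v (by simp [hv]))
      rw [hxy]
    by_cases hx : g.IsOn x
    · simp [MCX.act, hx, hon.1 hx]
    · simp [MCX.act, hx, mt hon.2 hx]
  · have hfix : ∀ z, g.act z w = z w := by
      intro z
      unfold MCX.act
      split_ifs
      · exact Function.update_of_ne hw _ _
      · rfl
    simp [hfix]

theorem isTriangular_circuitPerm (c : List (MCX W)) (r : W → ℕ)
    (hr : ∀ g ∈ c, ∀ v, (g.control v).isSome → r v < r g.target) :
    IsTriangular (fun w x => x w) r (circuitPerm c) := by
  refine (triangularSubmonoid _ r).list_prod_mem fun τ hτ => ?_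
  rw [List.mem_reverse, List.mem_map] at hτ
  obtain ⟨g, hg, rfl⟩ := hτ
  exact g.isTriangular_toPerm r (hr g hg)

/-- A permutation of wire mismatch at most `1` is in the Clifford hierarchy. -/
theorem HasWireMismatchLE.permGate_mem_cliffordHierarchy {σ : Equiv.Perm (W → Bool)}
    (hσ : HasWireMismatchLE 1 σ) : permGate σ ∈ cliffordHierarchy W := by
  classical
  obtain ⟨c, rfl, hc⟩ := hσ
  let T : W → Prop := fun w => ∃ g ∈ c, g.target = w ∧ ∃ v, (g.control v).isSome
  let C : W → Prop := fun w => ∃ g ∈ c, (g.control w).isSome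
  have huniq : ∀ u v, T u → C u → T v → C v → u = v := fun u v hu hu' hv hv' =>
    Finset.card_le_one.1 hc u (by simpa using ⟨hu, hu'⟩) v (by simpa using ⟨hv, hv'⟩)
  -- Rank `0` for wires that are not targets of controlled gates, `1` for the possible mismatched
  -- wire, `2` for wires that are only targets. A gate violating this order would need two
  -- mismatched wires; uncontrolled NOT gates impose no condition.
  refine (isTriangular_circuitPerm c (fun w => if T w then if C w then 1 else 2 else 0)
    fun g hg v hv => ?_).permGate_mem_cliffordHierarchy (fun x y h => funext h) ?_
  · have hTt : T g.target := ⟨g, hg, rfl, v, hv⟩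
    have hCv : C v := ⟨g, hg, hv⟩
    have hne : v ≠ g.target := by
      rintro rfl
      simp [g.control_target] at hv
    by_cases hCt : C g.target
    · have hTv : ¬ T v := fun hTv => hne (huniq _ _ hTv hCv hTt hCt)
      simp [hTv, hTt, hCt]
    · by_cases hTv : T v <;> simp [hTv, hTt, hCt, hCv]
  · intro a w x y
    change xor (xor (a w) (x w)) (x w) = xor (xor (a w) (y w)) (y w)
    simp

end Triangular

/-! ### Adding controls -/

section AddControls

variable {K W : Type*} [Fintype K] [DecidableEq K] [Fintype W] [DecidableEq W]

omit [Fintype W] [DecidableEq W] in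
theorem addControls_apply_inl (p : K → Bool) (σ : Equiv.Perm (W → Bool)) (x : K ⊕ W → Bool)
    (k : K) : addControls p σ x (Sum.inl k) = x (Sum.inl k) := rfl

/-- Adding controls to a permutation that is triangular in affine coordinates yields a gate in the
Clifford hierarchy. -/
theorem IsTriangular.permGate_addControls_mem_cliffordHierarchy
    {f : W → (W → Bool) → Bool} {r : W → ℕ} {σ : Equiv.Perm (W → Bool)}
    (hσ : IsTriangular f r σ) (hf : ∀ x y, (∀ w, f w x = f w y) → x = y)
    (haff : ∀ a w x y, xor (f w (translation a x)) (f w x) = xor (f w (translation a y)) (f w y))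
    (p : K → Bool) : permGate (addControls p σ) ∈ cliffordHierarchy (K ⊕ W) := by
  -- The new wires get rank `0` and the old ranks shift up by one, so whether `σ` fires may affect
  -- every old coordinate.
  refine IsTriangular.permGate_mem_cliffordHierarchy
    (f := Sum.elim (fun k x => x (Sum.inl k)) fun w x => f w (x ∘ Sum.inr))
    (r := Sum.elim (fun _ => 0) fun w => r w + 1) ?_ ?_ ?_
  · rintro (k | w) x y h
    · simp [addControls_apply_inl]
    · have hK : x ∘ Sum.inl = y ∘ Sum.inl :=
        funext fun k => h (Sum.inl k) (Nat.succ_pos _)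
      have hW : ∀ v, r v < r w → f v (x ∘ Sum.inr) = f v (y ∘ Sum.inr) := fun v hv =>
        h (Sum.inr v) (Nat.succ_lt_succ hv)
      have hact : ∀ z : K ⊕ W → Bool, addControls p σ z ∘ Sum.inr =
          (if z ∘ Sum.inl = p then σ else 1) (z ∘ Sum.inr) := fun z => rfl
      simp only [Sum.elim_inr, hact, hK]
      split_ifs
      · exact hσ w _ _ hW
      · simp
  · intro x y h
    have hW := hf (x ∘ Sum.inr) (y ∘ Sum.inr) fun w => h (Sum.inr w)
    funext u
    rcases u with k | w
    · exact h (Sum.inl k)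
    · exact congrFun hW w
  · rintro a (k | w) x y
    · change xor (xor (a _) (x _)) (x _) = xor (xor (a _) (y _)) (y _)
      simp
    · exact haff (a ∘ Sum.inr) w (x ∘ Sum.inr) (y ∘ Sum.inr)

theorem IsTriangular.familyInCH {c : List (MCX W)} {f : W → (W → Bool) → Bool} {r : W → ℕ}
    (hc : IsTriangular f r (circuitPerm c)) (hf : ∀ x y, (∀ w, f w x = f w y) → x = y)
    (haff : ∀ a w x y, xor (f w (translation a x)) (f w x) = xor (f w (translation a y)) (f w y)) :
    FamilyInCH c := fun _ p =>
  hc.permGate_addControls_mem_cliffordHierarchy hf haff p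

/-- A circuit whose controls all have smaller rank than the target they control generates a family
in the Clifford hierarchy. -/
theorem familyInCH_of_rank (c : List (MCX W)) (r : W → ℕ)
    (hr : ∀ g ∈ c, ∀ v, (g.control v).isSome → r v < r g.target) : FamilyInCH c :=
  (isTriangular_circuitPerm c r hr).familyInCH (fun _ _ h => funext h) fun a w x y => by
    change xor (xor (a w) (x w)) (x w) = xor (xor (a w) (y w)) (y w)
    simp

/-- The coordinates on four bits that add the bit `u` to the bit `t`. -/
def addBit (u t w : Fin 4) (x : Fin 4 → Bool) : Bool :=
  if w = t then xor (x t) (x u) else x w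

theorem addBit_injective {u t : Fin 4} (hut : u ≠ t) (x y : Fin 4 → Bool)
    (h : ∀ w, addBit u t w x = addBit u t w y) : x = y := by
  have hu : x u = y u := by simpa [addBit, hut] using h u
  funext w
  by_cases hw : w = t
  · subst hw
    simpa [addBit, hu] using h w
  · simpa [addBit, hw] using h w

theorem addBit_affine (u t : Fin 4) (a : Fin 4 → Bool) (w : Fin 4) (x y : Fin 4 → Bool) :
    xor (addBit u t w (translation a x)) (addBit u t w x) =
      xor (addBit u t w (translation a y)) (addBit u t w y) := by
  have hx : ∀ z v, translation a z v = xor (a v) (z v) := fun _ _ => rfl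
  unfold addBit
  simp only [hx]
  split_ifs
  · cases a t <;> cases a u <;> cases x t <;> cases x u <;> cases y t <;> cases y u <;> rfl
  · simp

theorem familyInCH_gen222 : FamilyInCH gen222 := by
  -- The two CNOTs from wire `2` to wire `3` change to the coordinate `x 3 ⊕ x 2` and back. In these
  -- coordinates bit `3` is unchanged, bit `1` depends on bits `0, 3`, and bit `2` on bits `0, 1,
  -- 3`, whence the ranks.
  refine IsTriangular.familyInCH (f := addBit 2 3) (r := ![0, 2, 3, 1]) ?_
    (addBit_injective (by decide)) (addBit_affine 2 3)
  unfold IsTriangular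
  decide +kernel

theorem familyInCH_gen222' : FamilyInCH gen222' := by
  -- The outer CNOTs pass to the coordinate `x 2 ⊕ x 3` and back; what remains only flips bit `3`,
  -- controlled by the other three coordinates.
  refine IsTriangular.familyInCH (f := addBit 3 2) (r := ![0, 0, 1, 2]) ?_
    (addBit_injective (by decide)) (addBit_affine 3 2)
  unfold IsTriangular
  decide +kernel

end AddControls

theorem mainTheorem7 :
    (∀ (W : Type*) [Fintype W] [DecidableEq W] (P L Q R : Equiv.Perm (W → Bool)),
      IsCliffordPerm L → HasWireMismatchLE 1 Q → IsCliffordPerm R →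
      permGate P = permGate L * permGate Q * permGate R →
      permGate P ∈ cliffordHierarchy W) ∧
    FamilyInCH gen2 ∧ FamilyInCH gen22 ∧ FamilyInCH gen4 ∧
    FamilyInCH gen222 ∧ FamilyInCH gen222' ∧ FamilyInCH gen42 := by
  -- For these generators the original wires suffice as coordinates, each ranked above the controls
  -- of the gates targeting it.
  refine ⟨?_, familyInCH_of_rank gen2 ![0, 0, 1] (by decide),
    familyInCH_of_rank gen22 ![0, 0, 0, 1] (by decide),
    familyInCH_of_rank gen4 ![0, 0, 1, 2] (by decide),
    familyInCH_gen222, familyInCH_gen222', familyInCH_of_rank gen42 ![0, 2, 1] (by decide)⟩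
  intro W _ _ P L Q R hL hQ hR hP
  rw [hP]
  exact clifford_mul_mul_clifford_mem_cliffordHierarchy hL hQ.permGate_mem_cliffordHierarchy hR
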